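/- \label{thm:streaming_d} \textbf{Setting.} Fix $1\le p\le\infty$, $d\ge 1$, and give $\mathbb R^d$ the $L_p$ metric. For a finite point set $P\subset\mathbb R^d$ let $\mathrm{OPT}(P)$ be the smallest number of closed balls of radius $1$ (with arbitrary centers) whose union contains $P$ (the unit disc cover problem). A streaming algorithm reads its input points one after another, in $k\ge 1$ passes, and may use randomness; it uses $b$ bits of space if its memory, which holds everything that is kept from one input point to the next (including stored random bits), has at most $2^b$ possible contents. After the last pass it outputs a real number. It is an algorithm for unit disc cover with approximation ratio $r$ and success probability $q$ on a class of streams if, for every stream of the class with point set $P$, with probability at least $q$ its output $v$ satisfies $\mathrm{OPT}(P)\le v\le r\,\mathrm{OPT}(P)$. The streams consist of at most $n\ge 2$ points whose coordinates are bounded by $\mathrm{poly}(n)$ and represented by $O(\log n)$ bits: for a constant $\kappa$, all coordinates belong to a known finite set $X\subset[-n^\kappa,n^\kappa]$ with $|X|\le n^\kappa$. For $\ell\ge 1$, a window of size $2\ell\times\dots\times2\ell$ is a half-open cube $\prod_{j=1}^d[2v_j,2v_j+2\ell)$ with $v\in\mathbb Z^d$. \textbf{Theorem.} For every $\kappa\in\mathbb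 N$ there is a constant $C>0$, depending only on $\kappa$, such that the following holds for all $p\in[1,\infty]$, all $d,\ell\ge 1$ with $\ell d\ge 2$, all $n\ge 2$, $k\ge 1$, $s\ge0$, $0<\varepsilon\le 1/2$, $r_{\mathcal A}\in\mathbb R$ and all $X$ as above. Let $\mathcal A$ be a $k$-pass streaming algorithm for unit disc cover restricted to windows of size $2\ell\times\dots\times2\ell$: for each window $W$ it gives an algorithm $\mathcal A_W$ which uses $s$ bits of space and which, on the streams of at most $n$ points that lie in $W$ and have their coordinates in $X$, has approximation ratio $r_{\mathcal A}$ with probability $1$. Put $s_h=d\log(1/\varepsilon)\log n$. Then there is a $k$-pass streaming algorithm for unit disc cover on all streams of at most $n$ points with coordinates in $X$ that has approximation ratio $(1+\varepsilon)\left(1+\frac4\ell\right)^d r_{\mathcal A}$ and success probability at least $0.99$ and that uses at most $$C\,\varepsilon^{-2}\,d^{2d+2}\,\ell^{2d}\,\log(\ell d)\,(s+s_h)$$ bits of space. -/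

import Mathlib

open scoped ENNReal NNReal

/-- A randomized streaming algorithm reading a stream of elements of `α`, with arbitrary (unbounded)
computation per item. All information that is kept between two consecutive items, including every
random choice that is to be used again later, is kept in `State`; fresh random bits may be drawn at
every step. `endPass` is executed each time the end of the stream is reached. -/
structure StreamingAlgorithm (α : Type) where
  State : Type
  fintypeState : Fintype State
  init : PMF State
  step : State → α → PMF State
  endPass : State → PMF State
  output : State → ℝ

namespace StreamingAlgorithm

variable {α : Type}

/-- The algorithm uses (at most) `s` bits of space: its memory has at most `2 ^ s` contents. -/
def UsesBits (A : StreamingAlgorithm α) (s : ℕ) : Prop :=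
  @Fintype.card A.State A.fintypeState ≤ 2 ^ s

/-- Distribution of the memory after reading the items of a list in order, from a given memory. -/
noncomputable def process (A : StreamingAlgorithm α) : List α → A.State → PMF A.State
  | [], σ => PMF.pure σ
  | x :: xs, σ => (A.step σ x).bind (A.process xs)

/-- Distribution of the memory after `k` passes over the stream `xs`, from a given memory. -/
noncomputable def runPasses (A : StreamingAlgorithm α) (xs : List α) : ℕ → A.State → PMF A.State
  | 0, σ => PMF.pure σ
  | k + 1, σ => ((A.process xs σ).bind A.endPass).bind (A.runPasses xs k)

/-- Distribution of the memory at the end of a complete run with `k` passes over `xs`. -/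
noncomputable def finalState (A : StreamingAlgorithm α) (k : ℕ) (xs : List α) : PMF A.State :=
  A.init.bind (A.runPasses xs k)

end StreamingAlgorithm

/-- `ℝ^d` with the `L_p` metric. -/
abbrev LpSpace (p : ℝ≥0∞) (d : ℕ) : Type := PiLp p (fun _ : Fin d => ℝ)

/-- The optimal value of the unit disc cover problem for the points of `xs` in `L_p`: the smallest
number of closed unit balls, with arbitrary centers in `ℝ^d`, whose union contains all points. -/
noncomputable def unitDiscCover (p : ℝ≥0∞) [Fact (1 ≤ p)] {d : ℕ} (xs : List (LpSpace p d)) : ℕ :=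
  (Metric.externalCoveringNumber 1 {x | x ∈ xs}).toNat

/-- Finitely many points have a finite cover, so `unitDiscCover` is never a default value. -/
theorem unitDiscCover_cast (p : ℝ≥0∞) [Fact (1 ≤ p)] {d : ℕ} (xs : List (LpSpace p d)) :
    (unitDiscCover p xs : ℕ∞) = Metric.externalCoveringNumber 1 {x | x ∈ xs} := by
  refine ENat.natCast_toNat (ne_top_of_le_ne_top ?_
    (Metric.externalCoveringNumber_le_encard_self (ε := 1) {x | x ∈ xs}))
  exact (Set.encard_lt_top_iff.2 xs.finite_toSet).ne

/-- With probability at least `q`, the value that `A` outputs after `k` passes over `xs` is an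
`r`-approximation of the optimal value of unit disc cover on `xs`. -/
def ApproximatesUDC (p : ℝ≥0∞) [Fact (1 ≤ p)] {d : ℕ} (A : StreamingAlgorithm (LpSpace p d))
    (k : ℕ) (r : ℝ) (q : ℝ≥0∞) (xs : List (LpSpace p d)) : Prop :=
  q ≤ (A.finalState k xs).toOuterMeasure
    {σ | (unitDiscCover p xs : ℝ) ≤ A.output σ ∧ A.output σ ≤ r * (unitDiscCover p xs : ℝ)}

/-- The half-open `2ℓ × ⋯ × 2ℓ` window whose lowest corner is the even integer point `2 v`. -/
def window (p : ℝ≥0∞) {d : ℕ} (ℓ : ℕ) (v : Fin d → ℤ) : Set (LpSpace p d) :=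
  {x | ∀ i, 2 * (v i : ℝ) ≤ x i ∧ x i < 2 * (v i : ℝ) + 2 * (ℓ : ℝ)}

/-- Streams of at most `n` points, all coordinates of which belong to `X`. -/
def admissibleStreams (p : ℝ≥0∞) (d n : ℕ) (X : Finset ℝ) : Set (List (LpSpace p d)) :=
  {xs | xs.length ≤ n ∧ ∀ x ∈ xs, ∀ i, x i ∈ X}

/-! Each point lies in exactly `ℓ ^ d` windows with even integer corners. For every residue class of
corners modulo `ℓ` the windows tile space, so their optimal values sum to at least OPT; conversely a
unit ball meets at most `(ℓ + 1) ^ d` windows. Hence the sum `O` of the optimal values over all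
windows satisfies `ℓ ^ d * OPT ≤ O ≤ (ℓ + 1) ^ d * OPT`, and it suffices to estimate `O`; no random
shift is needed.

Each nonempty window contributes a value between 1 and `M = (ℓ * d) ^ d`
(`unitDiscCover_window_le`), so sampling works. A random affine function over a finite field assigns
nested sampling levels of rates `2 ^ (-j)`; the memory keeps the least level at which at most `t`
nonempty windows survive, with the states of their automata. Pairwise independence and Chebyshev's
inequality, summed over the relevant levels (`exists_bad_seeds`), show that `t` of order `M / δ ^ 2`
suffices.

Since the given algorithms succeed with probability 1, they may be taken deterministic. The virtual
state of all windows is then a deterministic function of the stream, and for a fixed seed its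
truncation can be updated by itself (`truncate_congr`). -/

/-! ### Derandomization and stored summaries -/

/-- An algorithm can be replaced by a deterministic automaton on `Fin (2 ^ s)` that keeps every
property of the output which holds almost surely. -/
theorem StreamingAlgorithm.UsesBits.exists_deterministic {α : Type} {A : StreamingAlgorithm α}
    {s : ℕ} (hA : A.UsesBits s) :
    ∃ (q₀ : Fin (2 ^ s)) (st : Fin (2 ^ s) → α → Fin (2 ^ s)) (en : Fin (2 ^ s) → Fin (2 ^ s))
      (out : Fin (2 ^ s) → ℝ), ∀ (k : ℕ) (xs : List α) (V : Set ℝ),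
        1 ≤ (A.finalState k xs).toOuterMeasure {σ | A.output σ ∈ V} →
          out ((fun q => en (xs.foldl st q))^[k] q₀) ∈ V := by
  classical
  let _ := A.fintypeState
  obtain ⟨f⟩ : Nonempty (A.State ↪ Fin (2 ^ s)) :=
    Function.Embedding.nonempty_of_card_le (by simpa [UsesBits] using hA)
  have : Nonempty A.State := ⟨A.init.support_nonempty.some⟩
  have hg : ∀ a, Function.invFun f (f a) = a := Function.leftInverse_invFun f.injective
  set g := Function.invFun f with hgdef
  -- Each random choice is fixed to some value of positive probability. The resulting run lies in
  -- the support, where almost sure properties hold.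
  refine ⟨f A.init.support_nonempty.some, fun q x => f (A.step (g q) x).support_nonempty.some,
    fun q => f (A.endPass (g q)).support_nonempty.some, fun q => A.output (g q), ?_⟩
  intro k xs V hV
  set st : Fin (2 ^ s) → α → Fin (2 ^ s) := fun q x => f (A.step (g q) x).support_nonempty.some
  set en : Fin (2 ^ s) → Fin (2 ^ s) := fun q => f (A.endPass (g q)).support_nonempty.some
  have hproc : ∀ (ys : List α) (σ : A.State),
      ∃ τ ∈ (A.process ys σ).support, ys.foldl st (f σ) = f τ := by
    intro ys
    induction ys with
    | nil => intro σ; exact ⟨σ, by simp [process], rfl⟩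
    | cons y ys ih =>
      intro σ
      obtain ⟨τ, hτ, he⟩ := ih (A.step σ y).support_nonempty.some
      refine ⟨τ, ?_, ?_⟩
      · rw [process, PMF.mem_support_bind_iff]
        exact ⟨_, (A.step σ y).support_nonempty.some_mem, hτ⟩
      · rw [List.foldl_cons, ← he]
        simp only [st, hg]
  have hruns : ∀ (k : ℕ) (σ : A.State), ∃ τ ∈ (A.runPasses xs k σ).support,
      (fun q => en (xs.foldl st q))^[k] (f σ) = f τ := by
    intro k
    induction k with
    | zero => intro σ; exact ⟨σ, by simp [runPasses], rfl⟩
    | succ k ih =>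
      intro σ
      obtain ⟨τ, hτ, he⟩ := hproc xs σ
      obtain ⟨ρ, hρ, he'⟩ := ih (A.endPass τ).support_nonempty.some
      refine ⟨ρ, ?_, ?_⟩
      · rw [runPasses, PMF.mem_support_bind_iff]
        refine ⟨_, ?_, hρ⟩
        rw [PMF.mem_support_bind_iff]
        exact ⟨τ, hτ, (A.endPass τ).support_nonempty.some_mem⟩
      · rw [Function.iterate_succ_apply, ← he', he]
        simp only [en, hg]
  obtain ⟨τ, hτ, he⟩ := hruns k A.init.support_nonempty.some
  have hsupp : (A.finalState k xs).support ⊆ {σ | A.output σ ∈ V} := by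
    rw [← PMF.toOuterMeasure_apply_eq_one_iff]
    refine le_antisymm ?_ hV
    calc _ ≤ (A.finalState k xs).toOuterMeasure Set.univ :=
          MeasureTheory.measure_mono (Set.subset_univ _)
      _ = 1 := (PMF.toOuterMeasure_apply_eq_one_iff _ _).2 (Set.subset_univ _)
  have hmem : τ ∈ (A.finalState k xs).support := by
    rw [finalState, PMF.mem_support_bind_iff]
    exact ⟨_, A.init.support_nonempty.some_mem, hτ⟩
  have := hsupp hmem
  rw [he]
  simpa [hg] using this

/-- A deterministic automaton with state space `Φ`, of which only a seeded summary
`summary ω φ` is stored, is a streaming algorithm if the summaries can be updated. -/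
theorem StreamingAlgorithm.exists_of_summary {α Φ Ω Z : Type} [Fintype Ω] [Nonempty Ω] [Fintype Z]
    (φ₀ : Φ) (st : Φ → α → Φ) (en : Φ → Φ) (summary : Ω → Φ → Z) (out : Ω → Z → ℝ) (b : ℕ)
    (hst : ∀ ω φ ψ x, summary ω φ = summary ω ψ → summary ω (st φ x) = summary ω (st ψ x))
    (hen : ∀ ω φ ψ, summary ω φ = summary ω ψ → summary ω (en φ) = summary ω (en ψ))
    (hb : Fintype.card Ω * Fintype.card Z ≤ 2 ^ b) :
    ∃ B : StreamingAlgorithm α, B.UsesBits b ∧ ∀ (k : ℕ) (xs : List α) (V : Set ℝ) (N : Finset Ω),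
      (∀ ω ∉ N, out ω (summary ω ((fun φ => en (xs.foldl st φ))^[k] φ₀)) ∈ V) →
      100 * N.card ≤ Fintype.card Ω →
        99 / 100 ≤ (B.finalState k xs).toOuterMeasure {σ | B.output σ ∈ V} := by
  classical
  have : Nonempty Φ := ⟨φ₀⟩
  -- A stored summary is updated through an arbitrary state having it; `hst` and `hen` make the
  -- choice immaterial. The default value of `invFun` is never met in a run.
  set inv : Ω → Z → Φ := fun ω => Function.invFun (summary ω) with hinv
  have hi : ∀ ω φ, summary ω (inv ω (summary ω φ)) = summary ω φ := fun ω φ =>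
    Function.invFun_eq ⟨φ, rfl⟩
  let B : StreamingAlgorithm α :=
    { State := Ω × Z
      fintypeState := inferInstance
      init := (PMF.uniformOfFintype Ω).map fun ω => (ω, summary ω φ₀)
      step := fun σ x => PMF.pure (σ.1, summary σ.1 (st (inv σ.1 σ.2) x))
      endPass := fun σ => PMF.pure (σ.1, summary σ.1 (en (inv σ.1 σ.2)))
      output := fun σ => out σ.1 σ.2 }
  refine ⟨B, ?_, ?_⟩
  · change Fintype.card (Ω × Z) ≤ 2 ^ b
    rwa [Fintype.card_prod]
  intro k xs V N hN hcard
  have hproc : ∀ (ys : List α) (ω : Ω) (φ : Φ), B.process ys (ω, summary ω φ) =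
      PMF.pure (ω, summary ω (ys.foldl st φ)) := by
    intro ys
    induction ys with
    | nil => intro ω φ; rfl
    | cons y ys ih =>
      intro ω φ
      change (PMF.pure (ω, summary ω (st (inv ω (summary ω φ)) y))).bind (B.process ys) = _
      rw [PMF.pure_bind, hst ω _ φ y (hi ω φ), ih]
      rfl
  have hruns : ∀ (k : ℕ) (ω : Ω) (φ : Φ), B.runPasses xs k (ω, summary ω φ) =
      PMF.pure (ω, summary ω ((fun φ => en (xs.foldl st φ))^[k] φ)) := by
    intro k
    induction k with
    | zero => intro ω φ; rfl
    | succ k ih =>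
      intro ω φ
      rw [runPasses, hproc, PMF.pure_bind]
      change (PMF.pure (ω, summary ω (en (inv ω (summary ω (xs.foldl st φ)))))).bind _ = _
      rw [PMF.pure_bind, hen ω _ _ (hi ω _), ih, Function.iterate_succ_apply]
  have hfin : B.finalState k xs = (PMF.uniformOfFintype Ω).map fun ω =>
      (ω, summary ω ((fun φ => en (xs.foldl st φ))^[k] φ₀)) := by
    change ((PMF.uniformOfFintype Ω).map fun ω => (ω, summary ω φ₀)).bind _ = _
    rw [PMF.bind_map, PMF.map]
    congr 1
    funext ω
    exact hruns k ω φ₀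
  rw [hfin, PMF.toOuterMeasure_map_apply, PMF.toOuterMeasure_uniformOfFintype_apply]
  have hle : (Finset.univ \ N).card ≤ Fintype.card ((fun ω =>
      ((ω, summary ω ((fun φ => en (xs.foldl st φ))^[k] φ₀)) : Ω × Z)) ⁻¹'
        {σ | B.output σ ∈ V}) := by
    rw [← Fintype.card_coe]
    exact Fintype.card_le_of_injective
      (fun ω => ⟨ω.1, hN _ (Finset.mem_sdiff.1 ω.2).2⟩)
      fun a c h => Subtype.ext (Subtype.mk.inj h)
  have hN' : (Finset.univ \ N).card + N.card = Fintype.card Ω := by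
    rw [Finset.card_sdiff_add_card, Finset.union_eq_left.2 (Finset.subset_univ _),
      Finset.card_univ]
  have h99 : 99 * Fintype.card Ω ≤ 100 * (Finset.univ \ N).card := by omega
  have hle' : 99 / 100 * (Fintype.card Ω : ℝ≥0∞) ≤ ((Finset.univ \ N).card : ℝ≥0∞) := by
    have h : (99 : ℝ≥0∞) * Fintype.card Ω ≤ ((Finset.univ \ N).card : ℝ≥0∞) * 100 := by
      rw [mul_comm _ (100 : ℝ≥0∞)]
      exact_mod_cast h99
    rw [mul_comm, ← mul_div_assoc, mul_comm]
    exact ENNReal.div_le_of_le_mul h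
  rw [ENNReal.le_div_iff_mul_le (Or.inl (Nat.cast_ne_zero.2 Fintype.card_ne_zero))
    (Or.inl (ENNReal.natCast_ne_top _))]
  exact hle'.trans (Nat.cast_le.2 hle)

/-! ### One automaton per window -/

section WindowedAutomata

variable {α U Q : Type} (W : U → Set α) (q₀ : U → Q) (st : U → Q → α → Q) (en : U → Q → Q)

open Classical in
/-- Feed `x` to the automata of all windows that contain it, starting them where necessary. -/
noncomputable def windowedStep (N : U → Option Q) (x : α) : U → Option Q := fun u =>
  if x ∈ W u then some (st u ((N u).getD (q₀ u)) x) else N u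

/-- The end of a pass for all automata that have been started. -/
def windowedEnd (N : U → Option Q) : U → Option Q := fun u => (N u).map (en u)

-- Automata of different windows do not interact, so each sees exactly the substream in its window.
open Classical in
theorem foldl_windowedStep (xs : List α) (N : U → Option Q) (u : U) :
    xs.foldl (windowedStep W q₀ st) N u = if xs.filter (· ∈ W u) = [] then N u else
      some ((xs.filter (· ∈ W u)).foldl (st u) ((N u).getD (q₀ u))) := by
  induction xs generalizing N with
  | nil => simp
  | cons x xs ih =>
    rw [List.foldl_cons, ih]
    by_cases hx : x ∈ W u
    · by_cases hxs : xs.filter (· ∈ W u) = []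
      · simp [windowedStep, hx, hxs]
      · simp [windowedStep, hx, hxs]
    · simp [windowedStep, hx]

-- From the second pass on, `getD` resumes the stored state instead of restarting. Without any pass
-- nothing is started, not even for a nonempty window, hence `k ≠ 0`.
open Classical in
theorem iterate_windowed (xs : List α) (k : ℕ) (hk : k ≠ 0) (u : U) :
    (fun N => windowedEnd en (xs.foldl (windowedStep W q₀ st) N))^[k] (fun _ => none) u =
      if xs.filter (· ∈ W u) = [] then none else
        some ((fun q => en u ((xs.filter (· ∈ W u)).foldl (st u) q))^[k] (q₀ u)) := by
  set ys := xs.filter (· ∈ W u) with hys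
  have hpass : ∀ N : U → Option Q, windowedEnd en (xs.foldl (windowedStep W q₀ st) N) u =
      if ys = [] then (N u).map (en u) else some (en u (ys.foldl (st u) ((N u).getD (q₀ u)))) := by
    intro N
    rw [windowedEnd, foldl_windowedStep, ← hys]
    split_ifs <;> rfl
  split_ifs with h
  · have : ∀ (k : ℕ) (N : U → Option Q), N u = none →
        (fun N => windowedEnd en (xs.foldl (windowedStep W q₀ st) N))^[k] N u = none := by
      intro k
      induction k with
      | zero => intro N hN; exact hN
      | succ k ih =>
        intro N hN
        rw [Function.iterate_succ_apply]
        refine ih _ ?_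
        rw [hpass, if_pos h, hN, Option.map_none]
    exact this k _ rfl
  · have : ∀ (k : ℕ) (N : U → Option Q),
        (fun N => windowedEnd en (xs.foldl (windowedStep W q₀ st) N))^[k + 1] N u =
          some ((fun q => en u (ys.foldl (st u) q))^[k + 1] ((N u).getD (q₀ u))) := by
      intro k
      induction k with
      | zero => intro N; simpa [h] using hpass N
      | succ k ih =>
        intro N
        rw [Function.iterate_succ_apply, ih, hpass, if_neg h, Option.getD_some,
          Function.iterate_succ_apply (n := k + 1)]
    obtain ⟨k, rfl⟩ := Nat.exists_eq_succ_of_ne_zero hk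
    exact this k _

end WindowedAutomata

/-! ### Truncating partial maps to a sampling level -/

section Truncation

variable {U Q : Type}

/-- The indices at which a partial map is defined. -/
def Option.definedAt [Fintype U] (N : U → Option Q) : Finset U := {u | (N u).isSome}

theorem Option.mem_definedAt [Fintype U] {N : U → Option Q} {u : U} :
    u ∈ Option.definedAt N ↔ (N u).isSome := by simp [Option.definedAt]

variable [DecidableEq U]

/-- The least level at which at most `t` of the elements of `D` survive. -/
noncomputable def truncLevel (S : ℕ → Finset U) (t : ℕ) (D : Finset U) : ℕ :=
  sInf {j | (D ∩ S j).card ≤ t}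

/-- The empty level `L` makes the set under `sInf` nonempty, so the infimum is attained and is not
the default 0. -/
theorem card_inter_truncLevel {S : ℕ → Finset U} {L : ℕ} (hL : S L = ∅) (t : ℕ) (D : Finset U) :
    (D ∩ S (truncLevel S t D)).card ≤ t :=
  Nat.sInf_mem (s := {j | (D ∩ S j).card ≤ t}) ⟨L, by simp [hL]⟩

theorem truncLevel_le {S : ℕ → Finset U} {t j : ℕ} {D : Finset U} (h : (D ∩ S j).card ≤ t) :
    truncLevel S t D ≤ j := Nat.sInf_le h

theorem lt_card_inter_of_lt_truncLevel {S : ℕ → Finset U} {t j : ℕ} {D : Finset U}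
    (h : j < truncLevel S t D) : t < (D ∩ S j).card :=
  not_le.1 fun h' => absurd (truncLevel_le h') (not_le.2 h)

/-- Levels only see the elements that survive at a lower level. -/
theorem truncLevel_congr {S : ℕ → Finset U} (hS : Antitone S) {L : ℕ} (hL : S L = ∅) {t j : ℕ}
    {D D' : Finset U} (hD : j ≤ truncLevel S t D) (hD' : j ≤ truncLevel S t D')
    (h : D ∩ S j = D' ∩ S j) : truncLevel S t D = truncLevel S t D' := by
  have key : ∀ i, j ≤ i → D ∩ S i = D' ∩ S i := fun i hi => by
    have e : S i = S j ∩ S i := (Finset.inter_eq_right.2 (hS hi)).symm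
    rw [e, ← Finset.inter_assoc, h, Finset.inter_assoc]
  apply le_antisymm
  · apply truncLevel_le
    rw [key _ hD']
    exact card_inter_truncLevel hL t D'
  · apply truncLevel_le
    rw [← key _ hD]
    exact card_inter_truncLevel hL t D

/-- The level only rises as more windows become nonempty, so a discarded automaton is never needed
again. -/
theorem truncLevel_mono {S : ℕ → Finset U} {L : ℕ} (hL : S L = ∅) {t : ℕ}
    {D D' : Finset U} (h : D ⊆ D') : truncLevel S t D ≤ truncLevel S t D' :=
  truncLevel_le ((Finset.card_le_card (Finset.inter_subset_inter_right h)).trans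
    (card_inter_truncLevel hL t D'))

variable [Fintype U]

/-- The restriction of `N` to the elements that survive at its level. -/
noncomputable def truncate (S : ℕ → Finset U) (t : ℕ) (N : U → Option Q) : U → Option Q :=
  fun u => if u ∈ S (truncLevel S t (Option.definedAt N)) then N u else none

theorem definedAt_truncate (S : ℕ → Finset U) (t : ℕ) (N : U → Option Q) :
    Option.definedAt (truncate S t N) =
      Option.definedAt N ∩ S (truncLevel S t (Option.definedAt N)) := by
  ext u
  rw [Finset.mem_inter, Option.mem_definedAt, Option.mem_definedAt, truncate]
  split_ifs with h <;> simp [h]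

/-- A pointwise transformation of partial maps that never forgets an index can be carried out on
truncations. -/
theorem truncate_congr {S : ℕ → Finset U} (hS : Antitone S) {L : ℕ} (hL : S L = ∅) {t : ℕ}
    (f : U → Option Q → Option Q) (hf : ∀ u o, o.isSome → (f u o).isSome) {N N' : U → Option Q}
    (hlev : truncLevel S t (Option.definedAt N) = truncLevel S t (Option.definedAt N'))
    (htr : truncate S t N = truncate S t N') :
    truncLevel S t (Option.definedAt fun u => f u (N u)) =
        truncLevel S t (Option.definedAt fun u => f u (N' u)) ∧
      truncate S t (fun u => f u (N u)) = truncate S t (fun u => f u (N' u)) := by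
  have hsub : ∀ N : U → Option Q, Option.definedAt N ⊆ Option.definedAt fun u => f u (N u) :=
    fun N u hu => Option.mem_definedAt.2 (hf u _ (Option.mem_definedAt.1 hu))
  -- At surviving indices the truncation shows the map itself. The new level is no lower than the
  -- old one, so the new truncation consults only these indices.
  have hagree : ∀ u ∈ S (truncLevel S t (Option.definedAt N)), N u = N' u := by
    intro u hu
    have := congrFun htr u
    rwa [truncate, truncate, ← hlev, if_pos hu, if_pos hu] at this
  have h1 := truncLevel_mono (t := t) hL (hsub N)
  have h2 := truncLevel_mono (t := t) hL (hsub N')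
  have hl : truncLevel S t (Option.definedAt fun u => f u (N u)) =
      truncLevel S t (Option.definedAt fun u => f u (N' u)) := by
    refine truncLevel_congr hS hL h1 (hlev ▸ h2) ?_
    ext u
    simp only [Finset.mem_inter, Option.mem_definedAt]
    refine and_congr_left fun hu => ?_
    rw [hagree u hu]
  refine ⟨hl, funext fun u => ?_⟩
  unfold truncate
  rw [← hl]
  split_ifs with hu
  · exact congrArg (f u) (hagree u (hS h1 hu))
  · rfl

end Truncation

/-- The number of partial maps with at most `t` defined values. -/
theorem card_partialMaps_le {U Q : Type} [Fintype U] [Fintype Q] (t : ℕ) :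
    Nat.card {N : U → Option Q // (Option.definedAt N).card ≤ t} ≤
      (Fintype.card U * Fintype.card Q + 1) ^ t := by
  classical
  -- The graph of the map is written into `t` slots, each empty or holding one pair.
  have key : ∀ N : {N : U → Option Q // (Option.definedAt N).card ≤ t},
      ∃ φ : Fin t → Option (U × Q), ∀ u q, N.1 u = some q ↔ ∃ i, φ i = some (u, q) := by
    rintro ⟨N, hN⟩
    obtain ⟨e⟩ : Nonempty (Option.definedAt N ↪ Fin t) :=
      Function.Embedding.nonempty_of_card_le (by simpa using hN)
    refine ⟨fun i => if h : ∃ u, e u = i then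
      (N h.choose).map fun q => ((h.choose : U), q) else none, fun u q => ⟨fun h => ?_, ?_⟩⟩
    · have hu : u ∈ Option.definedAt N := Option.mem_definedAt.2 (Option.isSome_iff_exists.2 ⟨q, h⟩)
      refine ⟨e ⟨u, hu⟩, ?_⟩
      have hex : ∃ v, e v = e ⟨u, hu⟩ := ⟨_, rfl⟩
      have hch : hex.choose = ⟨u, hu⟩ := e.injective hex.choose_spec
      have h' : N u = some q := h
      dsimp only
      rw [dif_pos hex, hch, h', Option.map_some]
    · rintro ⟨i, hi⟩
      dsimp only at hi ⊢
      split_ifs at hi with h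
      rw [Option.map_eq_some_iff] at hi
      obtain ⟨q', hq', he⟩ := hi
      obtain ⟨h1, h2⟩ := Prod.ext_iff.1 he
      simp only at h1 h2
      rw [← h1, ← h2, hq']
  choose φ hφ using key
  have hinj : Function.Injective φ := by
    intro N N' h
    refine Subtype.ext (funext fun u => Option.ext fun q => ?_)
    rw [hφ, hφ, h]
  calc _ ≤ Nat.card (Fin t → Option (U × Q)) := Nat.card_le_card_of_injective φ hinj
    _ = _ := by simp [Nat.card_eq_fintype_card]

/-! ### Pairwise independent sampling -/

/-- Chebyshev's inequality for counting measure. -/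
theorem card_mul_sq_le_sum_sq {Ω : Type} [Fintype Ω] (f : Ω → ℝ) (bad : Finset Ω) {c : ℝ}
    (hc : 0 ≤ c) (h : ∀ ω ∈ bad, c < |f ω|) : (bad.card : ℝ) * c ^ 2 ≤ ∑ ω, f ω ^ 2 :=
  calc (bad.card : ℝ) * c ^ 2 = ∑ _ω ∈ bad, c ^ 2 := by simp
    _ ≤ ∑ ω ∈ bad, f ω ^ 2 := Finset.sum_le_sum fun ω hω =>
        (pow_le_pow_left₀ hc (h ω hω).le 2).trans_eq (sq_abs _)
    _ ≤ ∑ ω, f ω ^ 2 :=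
        Finset.sum_le_sum_of_subset_of_nonneg (Finset.subset_univ _) fun _ _ _ => sq_nonneg _

section Hashing

variable {F : Type} [Field F] [Fintype F] [DecidableEq F]

/-- For a fixed slope, the intercept and the value at `x` determine each other: every hash value is
uniform. -/
theorem card_affine_mem (T : Finset F) (x : F) :
    ({ω : F × F | ω.1 * x + ω.2 ∈ T} : Finset (F × F)).card = Fintype.card F * T.card := by
  rw [← Finset.card_univ, ← Finset.card_product]
  refine Finset.card_bij' (fun ω _ => (ω.1, ω.1 * x + ω.2)) (fun ω _ => (ω.1, ω.2 - ω.1 * x))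
    ?_ ?_ ?_ ?_ <;> simp

/-- Values at two distinct points determine an affine function uniquely: the hash values are
pairwise independent. -/
theorem card_affine_mem_mem (T : Finset F) {x y : F} (h : x ≠ y) :
    ({ω : F × F | ω.1 * x + ω.2 ∈ T ∧ ω.1 * y + ω.2 ∈ T} : Finset (F × F)).card =
      T.card * T.card := by
  have hxy : x - y ≠ 0 := sub_ne_zero.2 h
  rw [← Finset.card_product]
  refine Finset.card_bij' (fun ω _ => (ω.1 * x + ω.2, ω.1 * y + ω.2))
    (fun z _ => ((z.1 - z.2) / (x - y), z.1 - (z.1 - z.2) / (x - y) * x)) ?_ ?_ ?_ ?_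
  · simp
  · rintro ⟨z, w⟩ hz
    have e : (z - w) / (x - y) * y + (z - (z - w) / (x - y) * x) = w := by
      field_simp
      ring
    simpa [e] using hz
  · rintro ⟨a, b⟩ -
    ext
    · simp only
      field_simp
      ring
    · simp only
      field_simp
      ring
  · rintro ⟨z, w⟩ -
    ext
    · simp
    · simp only
      field_simp
      ring

/-- Second moment of a sum over the elements hashed into `T` by a random affine function. -/
theorem sum_sq_affine_le {U : Type} [DecidableEq U] {e : U → F} (he : Function.Injective e)
    (T : Finset F) (N : Finset U) (o : U → ℝ) :
    ∑ ω : F × F, (∑ u ∈ N, o u * ((if ω.1 * e u + ω.2 ∈ T then 1 else 0) -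
        (T.card : ℝ) / Fintype.card F)) ^ 2 ≤
      Fintype.card F * T.card * ∑ u ∈ N, o u ^ 2 := by
  set K : ℝ := (Fintype.card F : ℝ) with hK
  have hK0 : K ≠ 0 := Nat.cast_ne_zero.2 Fintype.card_ne_zero
  set q : ℝ := (T.card : ℝ) / K with hq
  have hqK : q * K = T.card := div_mul_cancel₀ _ hK0
  set ind : F × F → U → ℝ := fun ω u => if ω.1 * e u + ω.2 ∈ T then 1 else 0 with hind
  have h1 : ∀ u, ∑ ω, ind ω u = K * T.card := fun u => by
    rw [hind, Finset.sum_boole, card_affine_mem]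
    push_cast
    rfl
  have h2 : ∀ u v, u ≠ v → ∑ ω, ind ω u * ind ω v = T.card * T.card := fun u v huv => by
    have : ∀ ω, ind ω u * ind ω v =
        if ω.1 * e u + ω.2 ∈ T ∧ ω.1 * e v + ω.2 ∈ T then 1 else 0 := fun ω => by
      simp only [hind, ite_and]
      split_ifs <;> simp
    simp only [this]
    rw [Finset.sum_boole, card_affine_mem_mem _ (he.ne huv)]
    push_cast
    rfl
  have h3 : ∀ u, ∑ ω, ind ω u * ind ω u = K * T.card := fun u => by
    rw [← h1 u]
    refine Finset.sum_congr rfl fun ω _ => ?_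
    simp only [hind]
    split_ifs <;> simp
  -- Pairwise independence kills the off-diagonal covariances, leaving only the variances.
  have hcov : ∀ u v, ∑ ω, (ind ω u - q) * (ind ω v - q) =
      if u = v then K * T.card - T.card * T.card else 0 := fun u v => by
    have e1 : ∑ ω, (ind ω u - q) * (ind ω v - q) =
        ∑ ω, ind ω u * ind ω v - q * ∑ ω, ind ω v - q * ∑ ω, ind ω u + K * K * (q * q) := by
      rw [Finset.mul_sum, Finset.mul_sum, ← Finset.sum_sub_distrib, ← Finset.sum_sub_distrib]
      have : K * K * (q * q) = ∑ _ω : F × F, q * q := by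
        simp [hK, Fintype.card_prod]
      rw [this, ← Finset.sum_add_distrib]
      exact Finset.sum_congr rfl fun ω _ => by ring
    rw [e1, h1, h1]
    split_ifs with h
    · subst h
      rw [h3]
      linear_combination (-2 * T.card + q * K + T.card : ℝ) * hqK
    · rw [h2 u v h]
      linear_combination (-2 * T.card + q * K + T.card : ℝ) * hqK
  have hsq : ∀ ω, (∑ u ∈ N, o u * (ind ω u - q)) ^ 2 =
      ∑ u ∈ N, ∑ v ∈ N, o u * o v * ((ind ω u - q) * (ind ω v - q)) := fun ω => by
    rw [sq, Finset.sum_mul_sum]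
    exact Finset.sum_congr rfl fun u _ => Finset.sum_congr rfl fun v _ => by ring
  calc ∑ ω, (∑ u ∈ N, o u * (ind ω u - q)) ^ 2
      = ∑ u ∈ N, ∑ v ∈ N, o u * o v * ∑ ω, (ind ω u - q) * (ind ω v - q) := by
        simp only [hsq, Finset.mul_sum]
        rw [Finset.sum_comm]
        exact Finset.sum_congr rfl fun u _ => Finset.sum_comm
    _ = ∑ u ∈ N, o u ^ 2 * (K * T.card - T.card * T.card) := by
        refine Finset.sum_congr rfl fun u hu => ?_
        simp only [hcov, mul_ite, mul_zero]
        rw [Finset.sum_ite_eq, if_pos hu]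
        ring
    _ ≤ ∑ u ∈ N, o u ^ 2 * (K * T.card) := by
        gcongr
        have : (0 : ℝ) ≤ (T.card : ℝ) * T.card := by positivity
        linarith
    _ = K * T.card * ∑ u ∈ N, o u ^ 2 := by rw [← Finset.sum_mul, mul_comm]

/-- Chebyshev's inequality for sampling at rate `2 ^ (-j)` by a random affine function. -/
theorem card_bad_seeds_mul_le {U : Type} [DecidableEq U] {e : U → F} (he : Function.Injective e)
    {T : Finset F} {j : ℕ} (hT : T.card * 2 ^ j = Fintype.card F) {N : Finset U} {o : U → ℝ}
    {M δ : ℝ} (ho : ∀ u ∈ N, 1 ≤ o u) (hM : ∀ u ∈ N, o u ≤ M) (hM0 : 0 ≤ M) (hδ : 0 < δ) :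
    (({ω : F × F | δ * ∑ u ∈ N, o u < |2 ^ j * (∑ u ∈ N with ω.1 * e u + ω.2 ∈ T, o u) -
        ∑ u ∈ N, o u|} : Finset (F × F)).card : ℝ) * (δ ^ 2 * N.card) ≤
      (Fintype.card F : ℝ) ^ 2 * M * 2 ^ j := by
  set K : ℝ := (Fintype.card F : ℝ) with hK
  have hK0 : 0 < K := Nat.cast_pos.2 Fintype.card_pos
  have hTK : (T.card : ℝ) * 2 ^ j = K := by rw [hK, ← hT]; push_cast; rfl
  set O := ∑ u ∈ N, o u with hO
  set bad : Finset (F × F) := {ω : F × F | δ * O <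
    |2 ^ j * (∑ u ∈ N with ω.1 * e u + ω.2 ∈ T, o u) - O|} with hbad
  rcases N.eq_empty_or_nonempty with rfl | ⟨w, hw⟩
  · have : bad = ∅ := by simp [hbad, hO]
    rw [this, Finset.card_empty, Nat.cast_zero, zero_mul]
    positivity
  have hNO : (N.card : ℝ) ≤ O := by
    simpa using Finset.card_nsmul_le_sum N o 1 ho
  have hN0 : (0 : ℝ) < N.card := Nat.cast_pos.2 (Finset.card_pos.2 ⟨w, hw⟩)
  have hO0 : 0 < O := hN0.trans_le hNO
  -- The second moment is at most `M * O`, so one factor of Chebyshev's `(δ * O) ^ 2` cancels; the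
  -- remaining `O` is at least `N.card`.
  have hsqO : ∑ u ∈ N, o u ^ 2 ≤ M * O := by
    rw [hO, Finset.mul_sum]
    refine Finset.sum_le_sum fun u hu => ?_
    rw [sq]
    exact mul_le_mul_of_nonneg_right (hM u hu) (zero_le_one.trans (ho u hu))
  have hdev : ∀ ω : F × F, 2 ^ j * (∑ u ∈ N with ω.1 * e u + ω.2 ∈ T, o u) - O =
      2 ^ j * ∑ u ∈ N, o u * ((if ω.1 * e u + ω.2 ∈ T then 1 else 0) - (T.card : ℝ) / K) := by
    intro ω
    simp only [mul_sub, Finset.sum_sub_distrib, mul_ite, mul_one, mul_zero, ← Finset.sum_mul]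
    rw [← Finset.sum_filter, ← hO]
    have : 2 ^ j * (O * ((T.card : ℝ) / K)) = O := by
      rw [← hTK]
      have : (T.card : ℝ) ≠ 0 := fun h => by simp [h] at hTK; exact hK0.ne hTK
      field_simp
    rw [this]
  have hcheb : (bad.card : ℝ) * (δ * O) ^ 2 ≤ (2 ^ j) ^ 2 * (K * T.card * (M * O)) := by
    refine (card_mul_sq_le_sum_sq _ bad (mul_nonneg hδ.le hO0.le)
      fun ω hω => (Finset.mem_filter.1 hω).2).trans ?_
    simp only [hdev, mul_pow]
    rw [← Finset.mul_sum]
    gcongr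
    exact (sum_sq_affine_le he T N o).trans (by gcongr)
  have h2 : (2 ^ j : ℝ) ^ 2 * (K * T.card * (M * O)) = K ^ 2 * M * 2 ^ j * O := by
    rw [← hTK]; ring
  rw [h2] at hcheb
  have h3 : (bad.card : ℝ) * (δ ^ 2 * O) ≤ K ^ 2 * M * 2 ^ j := by
    refine le_of_mul_le_mul_right ?_ hO0
    calc _ = (bad.card : ℝ) * (δ * O) ^ 2 := by ring
      _ ≤ _ := hcheb
  refine le_trans ?_ h3
  gcongr

/-- With a capacity of `t` elements, for all but one percent of the affine functions the sum is
estimated well from the elements at the least level that does not exceed the capacity. -/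
theorem exists_bad_seeds {U : Type} [DecidableEq U] {e : U → F} (he : Function.Injective e)
    {T : ℕ → Finset F} {L : ℕ} (hT0 : T 0 = Finset.univ)
    (hT : ∀ j ≤ L, (T j).card * 2 ^ j = Fintype.card F) {N : Finset U} (hNL : N.card ≤ 2 ^ L)
    {o : U → ℝ} {M δ : ℝ} (ho : ∀ u ∈ N, 1 ≤ o u) (hM : ∀ u ∈ N, o u ≤ M) (hM1 : 1 ≤ M)
    (hδ : 0 < δ) (hδ1 : δ ≤ 1) {t : ℕ} (ht : 1200 * M ≤ δ ^ 2 * t) :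
    ∃ bad : Finset (F × F), 100 * bad.card ≤ Fintype.card (F × F) ∧ ∀ ω ∉ bad, ∀ j,
      (N.filter fun u => ω.1 * e u + ω.2 ∈ T j).card ≤ t →
      (∀ i < j, t < (N.filter fun u => ω.1 * e u + ω.2 ∈ T i).card) →
      |2 ^ j * (∑ u ∈ N with ω.1 * e u + ω.2 ∈ T j, o u) - ∑ u ∈ N, o u| ≤
        δ * ∑ u ∈ N, o u := by
  classical
  set bad : Finset (F × F) := {ω : F × F | ∃ j,
    (N.filter fun u => ω.1 * e u + ω.2 ∈ T j).card ≤ t ∧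
    (∀ i < j, t < (N.filter fun u => ω.1 * e u + ω.2 ∈ T i).card) ∧
    δ * ∑ u ∈ N, o u < |2 ^ j * (∑ u ∈ N with ω.1 * e u + ω.2 ∈ T j, o u) -
      ∑ u ∈ N, o u|} with hbad
  refine ⟨bad, ?_, fun ω hω j h1 h2 => ?_⟩
  swap
  · by_contra hcon
    exact hω (Finset.mem_filter.2 ⟨Finset.mem_univ _, j, h1, h2, not_le.1 hcon⟩)
  set O := ∑ u ∈ N, o u with hO
  have hO0 : 0 ≤ O := Finset.sum_nonneg fun u hu => zero_le_one.trans (ho u hu)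
  set D : ℕ → Finset (F × F) := fun j => {ω : F × F | δ * O <
    |2 ^ j * (∑ u ∈ N with ω.1 * e u + ω.2 ∈ T j, o u) - O|} with hD
  -- If everything fits, the stopping level is 0 and the estimate is exact.
  rcases le_or_gt N.card t with hNt | hNt
  · have : bad = ∅ := by
      refine Finset.filter_eq_empty_iff.2 fun ω _ => ?_
      rintro ⟨j, -, hj, hlt⟩
      rcases Nat.eq_zero_or_pos j with rfl | hpos
      · simp only [hT0, Finset.mem_univ, Finset.filter_true, pow_zero, one_mul] at hlt
        rw [← hO, sub_self, abs_zero] at hlt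
        exact absurd hlt (not_lt.2 (by positivity))
      · exact absurd (hj 0 hpos) (not_lt.2 ((Finset.card_filter_le _ _).trans hNt))
    simp [this]
  have ht1 : (1200 : ℝ) ≤ t := by nlinarith [pow_le_one₀ hδ.le hδ1 (n := 2)]
  have ht0 : 0 < t := by
    rcases Nat.eq_zero_or_pos t with h | h
    · rw [h] at ht1; norm_num at ht1
    · exact h
  -- The critical level `m`, where at most `t / 2` survivors are expected. Minimality gives `t * 2 ^
  -- m < 4 * N.card`, which also keeps `m ≤ L`.
  have hex : ∃ i, 2 * N.card ≤ t * 2 ^ i := ⟨N.card + 1, by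
    have := (Nat.lt_two_pow_self (n := N.card)).le
    rw [pow_succ]
    nlinarith⟩
  set m := Nat.find hex with hm
  have hm1 : 2 * N.card ≤ t * 2 ^ m := Nat.find_spec hex
  have hm0 : m ≠ 0 := fun h => by rw [h] at hm1; simp at hm1; omega
  obtain ⟨m', hm'⟩ := Nat.exists_eq_succ_of_ne_zero hm0
  have hm2 : t * 2 ^ m < 4 * N.card := by
    have := not_le.1 (Nat.find_min hex (m := m') (by omega))
    rw [hm', Nat.succ_eq_add_one, pow_succ, ← mul_assoc]
    omega
  have hmL : m ≤ L := by
    have h4 : 4 * 2 ^ m ≤ 4 * N.card := by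
      refine le_trans ?_ hm2.le
      gcongr
      exact_mod_cast (by linarith : (4 : ℝ) ≤ t)
    exact (Nat.pow_le_pow_iff_right (by norm_num : 1 < 2)).1 ((by omega : 2 ^ m ≤ N.card).trans hNL)
  -- Stopping above `m` means more than `t` survivors at level `m`, at least twice the expectation.
  -- This is a deviation event for unit weights, so only the levels up to `m` need a union bound.
  set E : Finset (F × F) := {ω : F × F | 1 * ∑ u ∈ N, (1 : ℝ) <
    |2 ^ m * (∑ u ∈ N with ω.1 * e u + ω.2 ∈ T m, (1 : ℝ)) - ∑ u ∈ N, (1 : ℝ)|} with hE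
  have hsub : bad ⊆ (Finset.range (m + 1)).biUnion D ∪ E := by
    intro ω hω
    obtain ⟨-, j, hj1, hj2, hj3⟩ := Finset.mem_filter.1 hω
    rw [Finset.mem_union, or_iff_not_imp_right]
    intro hωE
    have hjm : j ≤ m := by
      by_contra hcon
      have h5 := hj2 m (not_le.1 hcon)
      refine hωE (Finset.mem_filter.2 ⟨Finset.mem_univ _, ?_⟩)
      simp only [Finset.sum_const, nsmul_eq_mul, mul_one, one_mul]
      set c := (N.filter fun u => ω.1 * e u + ω.2 ∈ T m).card
      have h6 : t * 2 ^ m < 2 ^ m * c := by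
        rw [mul_comm]
        exact Nat.mul_lt_mul_of_pos_left h5 (by positivity)
      have h7 : (2 * N.card : ℝ) < 2 ^ m * c := by exact_mod_cast hm1.trans_lt h6
      exact lt_of_lt_of_le (by linarith) (le_abs_self _)
    exact Finset.mem_biUnion.2 ⟨j, Finset.mem_range.2 (by omega),
      Finset.mem_filter.2 ⟨Finset.mem_univ _, hj3⟩⟩
  set K : ℝ := (Fintype.card F : ℝ) with hK
  have hN0 : (0 : ℝ) < N.card := Nat.cast_pos.2 (by omega)
  have hDj : ∀ j ∈ Finset.range (m + 1), ((D j).card : ℝ) * (δ ^ 2 * N.card) ≤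
      K ^ 2 * M * 2 ^ j := fun j hj =>
    card_bad_seeds_mul_le he (hT j ((Nat.lt_succ_iff.1 (Finset.mem_range.1 hj)).trans hmL)) ho hM
      (zero_le_one.trans hM1) hδ
  have hEc : (E.card : ℝ) * (1 ^ 2 * N.card) ≤ K ^ 2 * 1 * 2 ^ m :=
    card_bad_seeds_mul_le he (hT m hmL) (fun _ _ => le_rfl) (fun _ _ => le_rfl)
      zero_le_one one_pos
  have hcard : (bad.card : ℝ) ≤ ∑ j ∈ Finset.range (m + 1), ((D j).card : ℝ) + E.card := by
    exact_mod_cast (Finset.card_le_card hsub).trans ((Finset.card_union_le _ _).trans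
      (Nat.add_le_add_right Finset.card_biUnion_le _))
  have hgeom : ∑ j ∈ Finset.range (m + 1), (2 : ℝ) ^ j ≤ 2 * 2 ^ m := by
    rw [geom_sum_eq (by norm_num), pow_succ]
    linarith
  have hδ2 : δ ^ 2 ≤ 1 := pow_le_one₀ hδ.le hδ1
  -- The geometric sum over the levels contributes `2 * 2 ^ m` and `E` one more `2 ^ m`. With `t * 2
  -- ^ m ≤ 4 * N.card` this gives the factor 12, and one percent requires 1200.
  have hmain : (bad.card : ℝ) * (δ ^ 2 * N.card) ≤ K ^ 2 * M * (3 * 2 ^ m) := by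
    calc (bad.card : ℝ) * (δ ^ 2 * N.card)
        ≤ (∑ j ∈ Finset.range (m + 1), ((D j).card : ℝ) + E.card) * (δ ^ 2 * N.card) := by gcongr
      _ = ∑ j ∈ Finset.range (m + 1), ((D j).card : ℝ) * (δ ^ 2 * N.card) +
            δ ^ 2 * (E.card * (1 ^ 2 * N.card)) := by rw [add_mul, Finset.sum_mul]; ring
      _ ≤ ∑ j ∈ Finset.range (m + 1), K ^ 2 * M * 2 ^ j + 1 * (K ^ 2 * 1 * 2 ^ m) := by
          exact add_le_add (Finset.sum_le_sum hDj)
            (mul_le_mul hδ2 hEc (by positivity) zero_le_one)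
      _ ≤ K ^ 2 * M * (2 * 2 ^ m) + 1 * (K ^ 2 * M * 2 ^ m) := by
          rw [← Finset.mul_sum]
          gcongr
      _ = _ := by ring
  have hm2' : (t : ℝ) * 2 ^ m ≤ 4 * N.card := by exact_mod_cast hm2.le
  have hfin : 100 * (bad.card : ℝ) ≤ K ^ 2 := by
    have hpos : 0 < 12 * M * N.card := by positivity
    refine le_of_mul_le_mul_right ?_ hpos
    calc 100 * (bad.card : ℝ) * (12 * M * N.card) = bad.card * N.card * (1200 * M) := by ring
      _ ≤ bad.card * N.card * (δ ^ 2 * t) := by gcongr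
      _ = bad.card * (δ ^ 2 * N.card) * t := by ring
      _ ≤ K ^ 2 * M * (3 * 2 ^ m) * t := by gcongr
      _ = K ^ 2 * M * 3 * (t * 2 ^ m) := by ring
      _ ≤ K ^ 2 * M * 3 * (4 * N.card) := by gcongr
      _ = _ := by ring
  rw [Fintype.card_prod, ← sq]
  rw [hK] at hfin
  exact_mod_cast hfin

end Hashing

/-- A finite type with `2 ^ L` elements has nested subsets of all sizes `2 ^ (L - j)`. -/
theorem exists_nested_subsets {F : Type} [Fintype F] {L : ℕ} (hF : Fintype.card F = 2 ^ L) :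
    ∃ T : ℕ → Finset F, Antitone T ∧ T 0 = Finset.univ ∧ T (L + 1) = ∅ ∧
      ∀ j ≤ L, (T j).card * 2 ^ j = Fintype.card F := by
  let f : F ≃ Fin (2 ^ L) := Fintype.equivFinOfCardEq hF
  -- Division of natural numbers makes the threshold 0 at level `L + 1`, which supplies the empty
  -- level.
  refine ⟨fun j => {x | (f x : ℕ) < 2 ^ L / 2 ^ j}, ?_, ?_, ?_, ?_⟩
  · intro i j hij x hx
    simp only [Finset.mem_filter, Finset.mem_univ, true_and] at hx ⊢
    exact hx.trans_le (Nat.div_le_div_left (Nat.pow_le_pow_right (by norm_num) hij) (by positivity))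
  · ext x
    simp
  · ext x
    have : 2 ^ L / 2 ^ (L + 1) = 0 := Nat.div_eq_of_lt (Nat.pow_lt_pow_right (by norm_num) (by omega))
    simp [this]
  · intro j hj
    have hd : 2 ^ j ∣ 2 ^ L := pow_dvd_pow 2 hj
    have hc : ({x | (f x : ℕ) < 2 ^ L / 2 ^ j} : Finset F).card = 2 ^ L / 2 ^ j := by
      rw [← Finset.card_map f.toEmbedding]
      have : ({x | (f x : ℕ) < 2 ^ L / 2 ^ j} : Finset F).map f.toEmbedding =
          ({i | (i : ℕ) < 2 ^ L / 2 ^ j} : Finset (Fin (2 ^ L))) := by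
        ext i
        simp [Finset.mem_map_equiv]
      rw [this, Fin.card_filter_val_lt]
      exact min_eq_right (Nat.div_le_self _ _)
    rw [hc, Nat.div_mul_cancel hd, hF]

/-! ### Geometry of the windows -/

/-- In this form, counting windows is counting integer points: each coordinate allows `ℓ`
consecutive corners. -/
theorem mem_window_iff {p : ℝ≥0∞} {d : ℕ} {ℓ : ℕ} {v : Fin d → ℤ} {x : LpSpace p d} : x ∈ window p ℓ v ↔
    ∀ i, v i ∈ Finset.Ioc (⌊x i / 2⌋ - (ℓ : ℤ)) ⌊x i / 2⌋ := by
  refine forall_congr' fun i => ?_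
  rw [Finset.mem_Ioc, Int.le_floor, sub_lt_iff_lt_add, Int.floor_lt, and_comm]
  push_cast
  constructor <;> rintro ⟨h1, h2⟩ <;> constructor <;> linarith

section Geometry

variable {p : ℝ≥0∞} [Fact (1 ≤ p)] {d : ℕ}

theorem unitDiscCover_le_card {xs : List (LpSpace p d)} (C : Finset (LpSpace p d))
    (h : ∀ x ∈ xs, ∃ c ∈ C, dist x c ≤ 1) : unitDiscCover p xs ≤ C.card := by
  have hC : Metric.IsCover 1 {x | x ∈ xs} (C : Set (LpSpace p d)) := by
    rw [Metric.isCover_iff_subset_iUnion_closedBall]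
    intro x hx
    obtain ⟨c, hc, hd⟩ := h x hx
    exact Set.mem_biUnion hc (by simpa using hd)
  have := hC.externalCoveringNumber_le_encard
  rw [← unitDiscCover_cast, Set.encard_coe_eq_coe_finsetCard] at this
  exact_mod_cast this

theorem exists_unitDiscCover (xs : List (LpSpace p d)) : ∃ C : Finset (LpSpace p d),
    C.card = unitDiscCover p xs ∧ ∀ x ∈ xs, ∃ c ∈ C, dist x c ≤ 1 := by
  have : ∃ C : Set (LpSpace p d), Metric.IsCover 1 {x | x ∈ xs} C ∧
      C.encard ≤ (unitDiscCover p xs : ℕ∞) := by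
    by_contra! hcon
    have h : ((unitDiscCover p xs : ℕ∞) + 1) ≤ Metric.externalCoveringNumber 1 {x | x ∈ xs} :=
      le_iInf₂ fun C hC => Order.add_one_le_of_lt (hcon C hC)
    rw [← unitDiscCover_cast] at h
    have h' : unitDiscCover p xs + 1 ≤ unitDiscCover p xs := by exact_mod_cast h
    omega
  obtain ⟨C, hC, hcard⟩ := this
  have hfin : C.Finite := Set.encard_lt_top_iff.1 (hcard.trans_lt (ENat.natCast_lt_top _))
  have hcov : ∀ x ∈ xs, ∃ c ∈ hfin.toFinset, dist x c ≤ 1 := by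
    intro x hx
    rw [Metric.isCover_iff_subset_iUnion_closedBall] at hC
    obtain ⟨c, hc, hd⟩ := Set.mem_iUnion₂.1 (hC hx)
    exact ⟨c, hfin.mem_toFinset.2 hc, by simpa using hd⟩
  refine ⟨hfin.toFinset, le_antisymm ?_ (unitDiscCover_le_card _ hcov), hcov⟩
  rw [hfin.encard_eq_coe_toFinset_card] at hcard
  exact_mod_cast hcard

@[simp]
theorem unitDiscCover_nil : unitDiscCover p ([] : List (LpSpace p d)) = 0 :=
  Nat.le_zero.1 (unitDiscCover_le_card ∅ (by simp))

theorem one_le_unitDiscCover {xs : List (LpSpace p d)} (h : xs ≠ []) :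
    1 ≤ unitDiscCover p xs := by
  obtain ⟨C, hC, hcov⟩ := exists_unitDiscCover xs
  obtain ⟨x, hx⟩ := List.exists_mem_of_ne_nil xs h
  obtain ⟨c, hc, -⟩ := hcov x hx
  rw [← hC]
  exact Finset.card_pos.2 ⟨c, hc⟩

/-- The triangle inequality over the coordinates gives a bound valid for all `p` at once. -/
theorem norm_le_sum_abs (x : LpSpace p d) : ‖x‖ ≤ ∑ i, |x i| := by
  have hx : x = ∑ i, PiLp.single p i (x i) := by
    ext j
    rw [WithLp.ofLp_sum, Finset.sum_apply]
    simp
  calc ‖x‖ = ‖∑ i, (PiLp.single p i (x i) : LpSpace p d)‖ := by rw [← hx]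
    _ ≤ ∑ i, ‖(PiLp.single p i (x i) : LpSpace p d)‖ := norm_sum_le _ _
    _ = ∑ i, |x i| := by simp [PiLp.norm_single]

/-- A window is covered by a grid of cubes of side `2 / d`. -/
theorem unitDiscCover_window_le (hd : 0 < d) {ℓ : ℕ} (v : Fin d → ℤ) {xs : List (LpSpace p d)}
    (h : ∀ x ∈ xs, x ∈ window p ℓ v) : unitDiscCover p xs ≤ (ℓ * d) ^ d := by
  classical
  have hd' : (0 : ℝ) < d := Nat.cast_pos.2 hd
  -- The cell centers: each coordinate is off by at most `1 / d`, so even the sum of the errors is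
  -- at most 1.
  let f : (Fin d → Fin (ℓ * d)) → LpSpace p d := fun g =>
    WithLp.toLp p fun i => 2 * (v i : ℝ) + (2 * (g i : ℕ) + 1) / d
  refine (unitDiscCover_le_card (Finset.univ.image f) ?_).trans
    (Finset.card_image_le.trans (by simp))
  intro x hx
  have hpos : ∀ i, 0 ≤ (x i - 2 * v i) * d / 2 := fun i => by
    have := (h x hx i).1
    have : 0 ≤ x i - 2 * v i := by linarith
    positivity
  have hlt : ∀ i, ⌊(x i - 2 * v i) * d / 2⌋₊ < ℓ * d := fun i => by
    rw [Nat.floor_lt (hpos i)]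
    have := (h x hx i).2
    push_cast
    nlinarith
  refine ⟨_, Finset.mem_image_of_mem f (Finset.mem_univ fun i => ⟨_, hlt i⟩), ?_⟩
  rw [dist_eq_norm]
  refine (norm_le_sum_abs _).trans ?_
  calc ∑ i, |(x - f fun i => ⟨_, hlt i⟩) i| ≤ ∑ _i : Fin d, (1 : ℝ) / d := by
        refine Finset.sum_le_sum fun i _ => ?_
        have h1 := Nat.floor_le (hpos i)
        have h2 := Nat.lt_floor_add_one ((x i - 2 * v i) * d / 2)
        set m : ℝ := (⌊(x i - 2 * v i) * d / 2⌋₊ : ℝ) with hm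
        have e : (x - f fun i => ⟨_, hlt i⟩) i = ((x i - 2 * v i) * d - (2 * m + 1)) / d := by
          have : (x - f fun i => ⟨_, hlt i⟩) i = x i - (2 * (v i : ℝ) + (2 * m + 1) / d) := rfl
          rw [this]
          field_simp
          ring
        rw [e, abs_div, abs_of_pos hd']
        gcongr
        rw [abs_le]
        constructor <;> linarith
    _ = 1 := by simp [hd'.ne']

open Classical in
/-- Every unit ball meets `(ℓ + 1) ^ d` windows at most. -/
theorem sum_unitDiscCover_window_le (ℓ : ℕ) (V : Finset (Fin d → ℤ)) (xs : List (LpSpace p d)) :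
    ∑ v ∈ V, unitDiscCover p (xs.filter (· ∈ window p ℓ v)) ≤
      (ℓ + 1) ^ d * unitDiscCover p xs := by
  obtain ⟨C, hC, hcov⟩ := exists_unitDiscCover xs
  let meets : LpSpace p d → (Fin d → ℤ) → Prop := fun c v => ∃ y ∈ window p ℓ v, dist y c ≤ 1
  have h1 : ∀ v, unitDiscCover p (xs.filter (· ∈ window p ℓ v)) ≤
      (C.filter fun c => meets c v).card := by
    intro v
    refine unitDiscCover_le_card _ fun x hx => ?_
    obtain ⟨hx1, hx2⟩ := List.mem_filter.1 hx
    obtain ⟨c, hc, hd⟩ := hcov x hx1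
    exact ⟨c, Finset.mem_filter.2 ⟨hc, x, by simpa using hx2, hd⟩, hd⟩
  -- The interval `[c i - 1, c i + 1]` has length 2, so `⌊y i / 2⌋` takes at most two consecutive
  -- values; this adds one corner to the `ℓ` of a point.
  have h2 : ∀ c, (V.filter fun v => meets c v).card ≤ (ℓ + 1) ^ d := by
    intro c
    have hsub : (V.filter fun v => meets c v) ⊆ Fintype.piFinset fun i =>
        Finset.Ioc (⌊(c i - 1) / 2⌋ - (ℓ : ℤ)) (⌊(c i - 1) / 2⌋ + 1) := by
      intro v hv
      obtain ⟨-, y, hy, hyc⟩ := Finset.mem_filter.1 hv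
      rw [Fintype.mem_piFinset]
      intro i
      obtain ⟨h3, h4⟩ := Finset.mem_Ioc.1 (mem_window_iff.1 hy i)
      have h5 : |y i - c i| ≤ 1 := by
        rw [dist_eq_norm] at hyc
        exact (PiLp.norm_apply_le (y - c) i).trans hyc
      obtain ⟨h6, h7⟩ := abs_le.1 h5
      have h8 : ⌊(c i - 1) / 2⌋ ≤ ⌊y i / 2⌋ := Int.floor_mono (by linarith)
      have h9 : ⌊y i / 2⌋ ≤ ⌊(c i - 1) / 2⌋ + 1 := by
        rw [← Int.floor_add_one]
        exact Int.floor_mono (by linarith)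
      rw [Finset.mem_Ioc]
      omega
    refine (Finset.card_le_card hsub).trans_eq ?_
    rw [Fintype.card_piFinset]
    have : ∀ z : ℤ, (Finset.Ioc (z - (ℓ : ℤ)) (z + 1)).card = ℓ + 1 := fun z => by
      rw [Int.card_Ioc]; omega
    simp [this]
  calc ∑ v ∈ V, unitDiscCover p (xs.filter (· ∈ window p ℓ v))
      ≤ ∑ v ∈ V, (C.filter fun c => meets c v).card := Finset.sum_le_sum fun v _ => h1 v
    _ = ∑ c ∈ C, (V.filter fun v => meets c v).card :=
        (Finset.sum_card_bipartiteAbove_eq_sum_card_bipartiteBelow (fun c v => meets c v)).symm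
    _ ≤ ∑ _c ∈ C, (ℓ + 1) ^ d := Finset.sum_le_sum fun c _ => h2 c
    _ = (ℓ + 1) ^ d * unitDiscCover p xs := by simp [hC, mul_comm]

open Classical in
/-- The windows that contain points form `ℓ ^ d` partitions of the point set. -/
theorem pow_mul_unitDiscCover_le {ℓ : ℕ} (hℓ : 0 < ℓ) (V : Finset (Fin d → ℤ))
    (xs : List (LpSpace p d)) (hV : ∀ x ∈ xs, ∀ v, x ∈ window p ℓ v → v ∈ V) :
    ℓ ^ d * unitDiscCover p xs ≤
      ∑ v ∈ V, unitDiscCover p (xs.filter (· ∈ window p ℓ v)) := by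
  choose C hC hcov using fun v => exists_unitDiscCover (xs.filter (· ∈ window p ℓ v))
  have hℓ' : (0 : ℤ) < ℓ := by exact_mod_cast hℓ
  -- Corners in one residue class modulo `ℓ` give a tiling, and the union of the local covers over
  -- that tiling covers all points.
  let R : Finset (Fin d → ℤ) := Fintype.piFinset fun _ => Finset.Ico 0 (ℓ : ℤ)
  let res : (Fin d → ℤ) → (Fin d → ℤ) := fun v i => v i % ℓ
  have hres : ∀ v ∈ V, res v ∈ R := fun v _ => Fintype.mem_piFinset.2 fun i =>
    Finset.mem_Ico.2 ⟨Int.emod_nonneg _ hℓ'.ne', Int.emod_lt_of_pos _ hℓ'⟩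
  have hR : R.card = ℓ ^ d := by simp [R, Fintype.card_piFinset]
  rw [← Finset.sum_fiberwise_of_maps_to hres, ← hR, ← smul_eq_mul]
  refine Finset.card_nsmul_le_sum _ _ _ fun ρ hρ => ?_
  calc unitDiscCover p xs ≤ ((V.filter fun v => res v = ρ).biUnion C).card := by
        refine unitDiscCover_le_card _ fun x hx => ?_
        let v : Fin d → ℤ := fun i => ⌊x i / 2⌋ - (⌊x i / 2⌋ - ρ i) % ℓ
        have hv : x ∈ window p ℓ v := by
          refine mem_window_iff.2 fun i => Finset.mem_Ioc.2 ?_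
          have h1 := Int.emod_nonneg (⌊x i / 2⌋ - ρ i) hℓ'.ne'
          have h2 := Int.emod_lt_of_pos (⌊x i / 2⌋ - ρ i) hℓ'
          constructor
          · simp only [v]; omega
          · simp only [v]; omega
        have hvρ : res v = ρ := by
          funext i
          have h1 := Finset.mem_Ico.1 (Fintype.mem_piFinset.1 hρ i)
          have h2 : v i = ρ i + ℓ * ((⌊x i / 2⌋ - ρ i) / ℓ) := by
            have := Int.emod_add_mul_ediv (⌊x i / 2⌋ - ρ i) ℓ
            simp only [v]
            linarith
          simp only [res]
          rw [h2, Int.add_mul_emod_self_left, Int.emod_eq_of_lt h1.1 h1.2]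
        obtain ⟨c, hc, hd⟩ := hcov v x (List.mem_filter.2 ⟨hx, by simpa using hv⟩)
        exact ⟨c, Finset.mem_biUnion.2 ⟨v, Finset.mem_filter.2 ⟨hV x hx v hv, hvρ⟩, hc⟩, hd⟩
    _ ≤ ∑ v ∈ V with res v = ρ, (C v).card := Finset.card_biUnion_le
    _ = _ := Finset.sum_congr rfl fun v _ => hC v

end Geometry

/-- The windows that can contain points with coordinates in `X`. -/
theorem exists_windows {p : ℝ≥0∞} {d : ℕ} (ℓ : ℕ) (X : Finset ℝ) : ∃ V : Finset (Fin d → ℤ),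
    V.card ≤ (X.card * ℓ) ^ d ∧
      ∀ x : LpSpace p d, (∀ i, x i ∈ X) → ∀ v, x ∈ window p ℓ v → v ∈ V := by
  classical
  refine ⟨Fintype.piFinset fun _ => X.biUnion fun x => Finset.Ioc (⌊x / 2⌋ - (ℓ : ℤ)) ⌊x / 2⌋,
    ?_, fun x hx v hv => Fintype.mem_piFinset.2 fun i =>
      Finset.mem_biUnion.2 ⟨x i, hx i, mem_window_iff.1 hv i⟩⟩
  rw [Fintype.card_piFinset_const]
  refine Nat.pow_le_pow_left (Finset.card_biUnion_le_card_mul _ _ _ fun x _ => ?_) d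
  simp

/-! ### The sampling algorithm -/

open Classical in
/-- Sampling windows: if for every window `u` an automaton estimates a quantity `o u ∈ [1, M]` of
the stream restricted to `u`, then a streaming algorithm that runs the automata of `t` sampled
windows estimates the sum of these quantities. -/
theorem exists_sampling_algorithm {α U : Type} [Fintype U] {a s t : ℕ}
    (hU : Fintype.card U ≤ 2 ^ a) (W : U → Set α) (q₀ : U → Fin (2 ^ s))
    (st : U → Fin (2 ^ s) → α → Fin (2 ^ s)) (en : U → Fin (2 ^ s) → Fin (2 ^ s))
    (out : U → Fin (2 ^ s) → ℝ) {M δ c : ℝ} (hM1 : 1 ≤ M) (hδ : 0 < δ) (hδ1 : δ ≤ 1) (hc : 0 ≤ c)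
    (ht : 1200 * M ≤ δ ^ 2 * t) :
    ∃ B : StreamingAlgorithm α, B.UsesBits (3 * a + 4 + t * (a + s + 1)) ∧
      ∀ (k : ℕ) (xs : List α) (o : U → ℝ) (r : ℝ), k ≠ 0 →
        (∀ u, xs.filter (· ∈ W u) = [] → o u = 0) →
        (∀ u, xs.filter (· ∈ W u) ≠ [] → 1 ≤ o u ∧ o u ≤ M ∧
          out u ((fun q => en u ((xs.filter (· ∈ W u)).foldl (st u) q))^[k] (q₀ u)) ∈
            Set.Icc (o u) (r * o u)) →
        99 / 100 ≤ (B.finalState k xs).toOuterMeasure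
          {σ | B.output σ ∈ Set.Icc (c * ((1 - δ) * ∑ u, o u)) (c * (r * ((1 + δ) * ∑ u, o u)))} := by
  -- The shift keeps the degree of the field positive when `a = 0`.
  set L := a + 1 with hL
  let F := GaloisField 2 L
  let _ : Fintype F := Fintype.ofFinite F
  have hF : Fintype.card F = 2 ^ L := by
    rw [← Nat.card_eq_fintype_card]
    exact GaloisField.card 2 L (by omega)
  have hUL : Fintype.card U ≤ 2 ^ L := hU.trans (Nat.pow_le_pow_right (by norm_num) (by omega))
  obtain ⟨e⟩ : Nonempty (U ↪ F) := Function.Embedding.nonempty_of_card_le (hUL.trans_eq hF.symm)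
  obtain ⟨T, hTanti, hT0, hTL, hT⟩ := exists_nested_subsets hF
  let S : F × F → ℕ → Finset U := fun ω j => {u | ω.1 * e u + ω.2 ∈ T j}
  have hSanti : ∀ ω, Antitone (S ω) := fun ω i j hij u hu =>
    Finset.mem_filter.2 ⟨Finset.mem_univ _, hTanti hij (Finset.mem_filter.1 hu).2⟩
  have hSL : ∀ ω, S ω (L + 1) = ∅ := fun ω => by simp [S, hTL]
  have hlev : ∀ ω D, truncLevel (S ω) t D < L + 2 := fun ω D =>
    Nat.lt_succ_of_le (truncLevel_le (by rw [hSL ω]; simp))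
  let Z : Type := Fin (L + 2) ×
    {N : U → Option (Fin (2 ^ s)) // (Option.definedAt N).card ≤ t}
  let summary : F × F → (U → Option (Fin (2 ^ s))) → Z := fun ω N =>
    (⟨truncLevel (S ω) t (Option.definedAt N), hlev ω _⟩,
      ⟨truncate (S ω) t N, by
        rw [definedAt_truncate]; exact card_inter_truncLevel (hSL ω) t _⟩)
  have hsum : ∀ (ω : F × F) (N N' : U → Option (Fin (2 ^ s))), summary ω N = summary ω N' ↔
      truncLevel (S ω) t (Option.definedAt N) = truncLevel (S ω) t (Option.definedAt N') ∧
        truncate (S ω) t N = truncate (S ω) t N' := fun ω N N' =>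
    ⟨fun h => ⟨congrArg (fun z : Z => (z.1 : ℕ)) h, congrArg (fun z : Z => z.2.1) h⟩,
      fun h => Prod.ext (Fin.ext h.1) (Subtype.ext h.2)⟩
  let outZ : F × F → Z → ℝ := fun _ z =>
    c * (2 ^ (z.1 : ℕ) * ∑ u, (z.2.1 u).elim 0 (out u))
  have hst : ∀ ω N N' x, summary ω N = summary ω N' →
      summary ω (windowedStep W q₀ st N x) = summary ω (windowedStep W q₀ st N' x) := by
    intro ω N N' x h
    rw [hsum] at h ⊢
    refine truncate_congr (hSanti ω) (hSL ω) (fun u o =>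
      if x ∈ W u then some (st u (o.getD (q₀ u)) x) else o) ?_ h.1 h.2
    intro u o ho
    split_ifs <;> simp [ho]
  have hen : ∀ ω N N', summary ω N = summary ω N' →
      summary ω (windowedEnd en N) = summary ω (windowedEnd en N') := by
    intro ω N N' h
    rw [hsum] at h ⊢
    refine truncate_congr (hSanti ω) (hSL ω) (fun u o => o.map (en u)) ?_ h.1 h.2
    intro u o ho
    simpa using ho
  -- The seed takes `2 * L` bits, the level `L + 1` bits, and each of the `t` slots `a + s + 1`
  -- bits.
  have hcard : Fintype.card (F × F) * Fintype.card Z ≤ 2 ^ (3 * a + 4 + t * (a + s + 1)) := by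
    have hP := card_partialMaps_le (U := U) (Q := Fin (2 ^ s)) t
    rw [Nat.card_eq_fintype_card, Fintype.card_fin] at hP
    have hL2 : L + 2 ≤ 2 ^ (L + 1) := Nat.lt_two_pow_self
    have hone : 1 ≤ 2 ^ a * 2 ^ s := Nat.succ_le_of_lt (by positivity)
    calc Fintype.card (F × F) * Fintype.card Z
        = 2 ^ L * 2 ^ L * ((L + 2) * Fintype.card
          {N : U → Option (Fin (2 ^ s)) // (Option.definedAt N).card ≤ t}) := by
          rw [Fintype.card_prod, Fintype.card_prod, hF, Fintype.card_fin]
      _ ≤ 2 ^ L * 2 ^ L * (2 ^ (L + 1) * (2 ^ a * 2 ^ s + 2 ^ a * 2 ^ s) ^ t) := by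
          gcongr
          refine hP.trans ?_
          gcongr
      _ = 2 ^ (3 * a + 4 + t * (a + s + 1)) := by
          rw [← mul_two (2 ^ a * 2 ^ s), ← pow_add 2 a s, ← pow_succ, ← pow_mul, ← pow_add, ← pow_add,
            ← pow_add]
          congr 1
          rw [hL]
          ring
  obtain ⟨B, hB, hBout⟩ := StreamingAlgorithm.exists_of_summary (α := α)
    (fun _ => none) (windowedStep W q₀ st) (windowedEnd en) summary outZ
    (3 * a + 4 + t * (a + s + 1)) hst hen hcard
  refine ⟨B, hB, fun k xs o r hk ho0 ho => ?_⟩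
  set N : Finset U := {u | xs.filter (· ∈ W u) ≠ []} with hN
  have hmemN : ∀ u, u ∈ N ↔ xs.filter (· ∈ W u) ≠ [] := fun u => by simp [hN]
  have hsumN : ∑ u, o u = ∑ u ∈ N, o u :=
    (Finset.sum_subset (Finset.subset_univ N) fun u _ hu =>
      ho0 u (not_not.1 (mt (hmemN u).2 hu))).symm
  obtain ⟨bad, hbad, hgood⟩ := exists_bad_seeds e.injective hT0 hT (N := N)
    ((Finset.card_le_univ _).trans hUL) (o := o) (fun u hu => (ho u ((hmemN u).1 hu)).1)
    (fun u hu => (ho u ((hmemN u).1 hu)).2.1) hM1 hδ hδ1 ht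
  refine hBout k xs _ bad (fun ω hω => ?_) hbad
  set fin := (fun N => windowedEnd en (xs.foldl (windowedStep W q₀ st) N))^[k] (fun _ => none)
    with hfin
  have hfinu : ∀ u, fin u = if xs.filter (· ∈ W u) = [] then none else
      some ((fun q => en u ((xs.filter (· ∈ W u)).foldl (st u) q))^[k] (q₀ u)) := fun u =>
    iterate_windowed W q₀ st en xs k hk u
  have hdef : Option.definedAt fin = N := by
    ext u
    rw [Option.mem_definedAt, hfinu, hmemN]
    split_ifs with h <;> simp [h]
  set j := truncLevel (S ω) t (Option.definedAt fin) with hj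
  have hNS : ∀ i, N ∩ S ω i = N.filter fun u => ω.1 * e u + ω.2 ∈ T i := fun i => by
    ext u; simp [S]
  have hest := hgood ω hω j
    (by rw [← hNS, ← hdef]; exact card_inter_truncLevel (hSL ω) t _)
    (fun i hi => by rw [← hNS, ← hdef]; exact lt_card_inter_of_lt_truncLevel hi)
  have hout : outZ ω (summary ω fin) =
      c * (2 ^ j * ∑ u ∈ N with ω.1 * e u + ω.2 ∈ T j,
        out u ((fun q => en u ((xs.filter (· ∈ W u)).foldl (st u) q))^[k] (q₀ u))) := by
    have hu : ∀ u, (truncate (S ω) t fin u).elim 0 (out u) =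
        if u ∈ N.filter (fun u => ω.1 * e u + ω.2 ∈ T j) then
          out u ((fun q => en u ((xs.filter (· ∈ W u)).foldl (st u) q))^[k] (q₀ u)) else 0 := by
      intro u
      have hmem : u ∈ N.filter (fun u => ω.1 * e u + ω.2 ∈ T j) ↔
          xs.filter (· ∈ W u) ≠ [] ∧ u ∈ S ω j := by
        rw [← hNS, Finset.mem_inter, hmemN]
      simp only [hmem]
      rw [truncate, ← hj, hfinu]
      by_cases h1 : u ∈ S ω j <;> by_cases h2 : xs.filter (· ∈ W u) = [] <;> simp [h1, h2]
    change c * (2 ^ j * ∑ u, (truncate (S ω) t fin u).elim 0 (out u)) = _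
    simp only [hu]
    rw [Finset.sum_ite_mem, Finset.univ_inter]
  rw [hout, hsumN]
  set O := ∑ u ∈ N, o u with hO
  have hY : ∑ u ∈ N with ω.1 * e u + ω.2 ∈ T j, o u ≤
      ∑ u ∈ N with ω.1 * e u + ω.2 ∈ T j,
        out u ((fun q => en u ((xs.filter (· ∈ W u)).foldl (st u) q))^[k] (q₀ u)) :=
    Finset.sum_le_sum fun u hu => (ho u ((hmemN u).1 (Finset.mem_filter.1 hu).1)).2.2.1
  have hY' : ∑ u ∈ N with ω.1 * e u + ω.2 ∈ T j,
        out u ((fun q => en u ((xs.filter (· ∈ W u)).foldl (st u) q))^[k] (q₀ u)) ≤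
      r * ∑ u ∈ N with ω.1 * e u + ω.2 ∈ T j, o u := by
    rw [Finset.mul_sum]
    exact Finset.sum_le_sum fun u hu => (ho u ((hmemN u).1 (Finset.mem_filter.1 hu).1)).2.2.2
  obtain ⟨h1, h2⟩ := abs_le.1 hest
  constructor
  · refine mul_le_mul_of_nonneg_left ?_ hc
    have := mul_le_mul_of_nonneg_left hY (by positivity : (0 : ℝ) ≤ 2 ^ j)
    linarith
  · refine mul_le_mul_of_nonneg_left ?_ hc
    -- The sign of `r` is known only from a nonempty window, where `o u ≤ r * o u` and `1 ≤ o u`.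
    rcases N.eq_empty_or_nonempty with hN0 | ⟨w, hw⟩
    · simp [hO, hN0]
    have hr : 0 ≤ r := by
      obtain ⟨hw1, -, hw2⟩ := ho w ((hmemN w).1 hw)
      have := hw2.1.trans hw2.2
      by_contra hneg
      nlinarith
    calc _ ≤ 2 ^ j * (r * ∑ u ∈ N with ω.1 * e u + ω.2 ∈ T j, o u) :=
          mul_le_mul_of_nonneg_left hY' (by positivity)
      _ = r * (2 ^ j * ∑ u ∈ N with ω.1 * e u + ω.2 ∈ T j, o u) := by ring
      _ ≤ r * ((1 + δ) * O) := mul_le_mul_of_nonneg_left (by linarith) hr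

/-! ### Space bound and assembly -/

/-- The space bound. -/
theorem space_bound {κ d ℓ n s t a : ℕ} {ε : ℝ} (hd : 0 < d) (hℓ : 0 < ℓ) (hℓd : 2 ≤ ℓ * d)
    (hn : 2 ≤ n) (hε : 0 < ε) (hε2 : ε ≤ 1 / 2)
    (ht : (t : ℝ) ≤ 19201 * ((ε ^ 2)⁻¹ * ((ℓ : ℝ) * d) ^ d)) (ht1 : 1 ≤ t)
    (ha : a = d * (κ * (Nat.log 2 n + 1) + (Nat.log 2 ℓ + 1))) :
    ((3 * a + 4 + t * (a + s + 1) : ℕ) : ℝ) ≤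
      5 * 19201 * (16 * κ + 32) * ((ε ^ 2)⁻¹ * (d : ℝ) ^ (2 * d + 2) * (ℓ : ℝ) ^ (2 * d) *
        Real.log ((ℓ : ℝ) * (d : ℝ)) *
        ((s : ℝ) + (d : ℝ) * Real.log (1 / ε) * Real.log (n : ℝ))) := by
  -- All three logarithms are at least `log 2 ≥ 1 / 2`, so missing factors can be inserted at
  -- constant cost.
  have hlog2 : (1 / 2 : ℝ) ≤ Real.log 2 := by have := Real.log_two_gt_d9; linarith
  have hd1 : (1 : ℝ) ≤ d := by exact_mod_cast hd
  have hℓ1 : (1 : ℝ) ≤ ℓ := by exact_mod_cast hℓ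
  have hℓd' : (2 : ℝ) ≤ ℓ * d := by exact_mod_cast hℓd
  have hn' : (2 : ℝ) ≤ n := by exact_mod_cast hn
  set Λ := Real.log ((ℓ : ℝ) * d)
  set E := Real.log (1 / ε)
  set lg := Real.log (n : ℝ)
  have hΛ : 1 / 2 ≤ Λ := hlog2.trans (Real.log_le_log (by norm_num) hℓd')
  have hlg : 1 / 2 ≤ lg := hlog2.trans (Real.log_le_log (by norm_num) hn')
  have hE : 1 / 2 ≤ E := by
    refine hlog2.trans (Real.log_le_log (by norm_num) ?_)
    rw [le_div_iff₀ hε]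
    linarith
  have hnat : ∀ m : ℕ, 1 ≤ m → (Nat.log 2 m : ℝ) ≤ 2 * Real.log m := fun m hm => by
    refine (Real.natLog_le_logb m 2).trans ?_
    have : 0 ≤ Real.log (m : ℝ) := Real.log_natCast_nonneg m
    rw [Real.logb, div_le_iff₀ (by positivity)]
    push_cast
    nlinarith
  have h1 := hnat n (by omega)
  have h2 : (Nat.log 2 ℓ : ℝ) ≤ 2 * Λ := (hnat ℓ hℓ).trans (by
    have : Real.log (ℓ : ℝ) ≤ Λ := Real.log_le_log (by positivity) (by nlinarith)
    linarith)
  have ha1 : (a : ℝ) ≤ d * (κ * (4 * lg) + 4 * Λ) := by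
    rw [ha]
    push_cast
    gcongr <;> linarith
  have hΛE : 1 / 4 ≤ Λ * E := by nlinarith
  have hElg : 1 / 4 ≤ E * lg := by nlinarith
  have ha2 : (a : ℝ) ≤ (16 * κ + 16) * (Λ * (d * E * lg)) := by
    refine ha1.trans ?_
    have h3 : (κ : ℝ) * d * (lg * 1) ≤ κ * d * (lg * (4 * (Λ * E))) := by gcongr; linarith
    have h4 : (d : ℝ) * (Λ * 1) ≤ d * (Λ * (4 * (E * lg))) := by gcongr; linarith
    nlinarith
  have h5 : (1 : ℝ) ≤ 8 * (Λ * (d * E * lg)) := by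
    have : 1 / 8 ≤ Λ * E * lg := by nlinarith
    nlinarith
  have hs : (s : ℝ) ≤ 2 * (Λ * s) := by
    have : (0 : ℝ) ≤ s := Nat.cast_nonneg s
    nlinarith
  have hsum : (a : ℝ) + s + 1 ≤ (16 * κ + 32) * (Λ * (s + d * E * lg)) := by
    have h6 : 0 ≤ Λ * s := by positivity
    have h7 : 0 ≤ (κ : ℝ) * (Λ * s) := by positivity
    have h8 : (16 * κ + 32) * (Λ * (s + d * E * lg)) =
      (16 * κ + 16) * (Λ * (d * E * lg)) + 16 * (Λ * (d * E * lg)) + 16 * (κ * (Λ * s)) +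
        32 * (Λ * s) := by ring
    rw [h8]
    linarith
  have hb : 3 * a + 4 + t * (a + s + 1) ≤ 5 * (t * (a + s + 1)) := by nlinarith
  have hpow : ((ℓ : ℝ) * d) ^ d ≤ (d : ℝ) ^ (2 * d + 2) * (ℓ : ℝ) ^ (2 * d) := by
    rw [mul_pow, mul_comm]
    gcongr <;> first | assumption | omega
  calc ((3 * a + 4 + t * (a + s + 1) : ℕ) : ℝ) ≤ ((5 * (t * (a + s + 1)) : ℕ) : ℝ) := by
        exact_mod_cast hb
    _ = 5 * (t * (a + s + 1)) := by push_cast; ring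
    _ ≤ 5 * (19201 * ((ε ^ 2)⁻¹ * ((d : ℝ) ^ (2 * d + 2) * (ℓ : ℝ) ^ (2 * d))) *
          ((16 * κ + 32) * (Λ * (s + d * E * lg)))) := by
        gcongr
        exact ht.trans (by gcongr)
    _ = _ := by ring

theorem mainTheorem2 (κ : ℕ) :
    ∃ C : ℝ, 0 < C ∧
      ∀ (p : ℝ≥0∞) [Fact (1 ≤ p)] (d ℓ n k s : ℕ) (ε r : ℝ) (X : Finset ℝ),
        2 ≤ ℓ * d → 2 ≤ n → 1 ≤ k → 0 < ε → ε ≤ 1 / 2 →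
        X.card ≤ n ^ κ → (∀ x ∈ X, |x| ≤ (n : ℝ) ^ κ) →
        ∀ A : (Fin d → ℤ) → StreamingAlgorithm (LpSpace p d),
          (∀ v, (A v).UsesBits s) →
          (∀ v, ∀ xs ∈ admissibleStreams p d n X, (∀ x ∈ xs, x ∈ window p ℓ v) →
            ApproximatesUDC p (A v) k r 1 xs) →
          ∃ (B : StreamingAlgorithm (LpSpace p d)) (b : ℕ),
            B.UsesBits b ∧
            (b : ℝ) ≤ C * ((ε ^ 2)⁻¹ * (d : ℝ) ^ (2 * d + 2) * (ℓ : ℝ) ^ (2 * d) *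
              Real.log ((ℓ : ℝ) * (d : ℝ)) *
              ((s : ℝ) + (d : ℝ) * Real.log (1 / ε) * Real.log (n : ℝ))) ∧
            ∀ xs ∈ admissibleStreams p d n X,
              ApproximatesUDC p B k ((1 + ε) * (1 + 4 / (ℓ : ℝ)) ^ d * r) (99 / 100) xs := by
  classical
  refine ⟨5 * 19201 * (16 * κ + 32), by positivity, ?_⟩
  intro p _ d ℓ n k s ε r X hℓd hn hk hε hε2 hX _ A hA hAapp
  have hd : 0 < d := Nat.pos_of_ne_zero fun h => by simp [h] at hℓd
  have hℓ : 0 < ℓ := Nat.pos_of_ne_zero fun h => by simp [h] at hℓd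
  have hℓ0 : (0 : ℝ) < ℓ := Nat.cast_pos.2 hℓ
  obtain ⟨V, hVcard, hV⟩ := exists_windows (p := p) (d := d) ℓ X
  set a := d * (κ * (Nat.log 2 n + 1) + (Nat.log 2 ℓ + 1)) with ha
  have hVa : Fintype.card V ≤ 2 ^ a := by
    rw [Fintype.card_coe]
    calc V.card ≤ (X.card * ℓ) ^ d := hVcard
      _ ≤ (((2 ^ (Nat.log 2 n + 1)) ^ κ) * 2 ^ (Nat.log 2 ℓ + 1)) ^ d := by
          gcongr
          · exact hX.trans (Nat.pow_le_pow_left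
              (Nat.lt_pow_succ_log_self (by norm_num) n).le κ)
          · exact (Nat.lt_pow_succ_log_self (by norm_num) ℓ).le
      _ = 2 ^ a := by
          rw [← pow_mul, ← pow_add, ← pow_mul, ha]
          congr 1
          ring
  choose q₀ st en out hout using fun v : V => (hA v).exists_deterministic
  set M : ℝ := ((ℓ : ℝ) * d) ^ d with hMdef
  -- Small enough for `(1 + δ) / (1 - δ) ≤ 1 + ε`. The capacity is then `1200 * 16 * M / ε ^ 2`, and
  -- rounding up turns 19200 into 19201.
  set δ : ℝ := ε / 4 with hδdef
  have hM1 : 1 ≤ M := one_le_pow₀ (by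
    have : (2 : ℝ) ≤ ℓ * d := by exact_mod_cast hℓd
    linarith)
  have hδ : 0 < δ := by positivity
  have hδ8 : δ ≤ 1 / 8 := by linarith
  set t := ⌈1200 * M / δ ^ 2⌉₊ with htdef
  have ht : 1200 * M ≤ δ ^ 2 * t := by
    have := Nat.le_ceil (1200 * M / δ ^ 2)
    rw [div_le_iff₀ (by positivity)] at this
    linarith
  have hεinv : 1 ≤ (ε ^ 2)⁻¹ := (one_le_inv₀ (by positivity)).2
    (pow_le_one₀ hε.le (by linarith))
  have ht' : (t : ℝ) ≤ 19201 * ((ε ^ 2)⁻¹ * M) := by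
    have h1 := (Nat.ceil_lt_add_one (by positivity : 0 ≤ 1200 * M / δ ^ 2)).le
    have h2 : 1200 * M / δ ^ 2 = 19200 * ((ε ^ 2)⁻¹ * M) := by
      rw [hδdef]; field_simp; norm_num
    have h3 : 1 ≤ (ε ^ 2)⁻¹ * M := one_le_mul_of_one_le_of_one_le hεinv hM1
    rw [← htdef, h2] at h1
    linarith
  have ht1 : 1 ≤ t := Nat.one_le_ceil_iff.2 (by positivity)
  have hδ1' : 0 < 1 - δ := by linarith
  -- The scaling undoes the multiplicity `ℓ ^ d`; dividing by `1 - δ` as well prevents the output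
  -- from falling below the optimum.
  obtain ⟨B, hB, hBapp⟩ := exists_sampling_algorithm hVa (fun v : V => window p ℓ v.1)
    q₀ st en out hM1 hδ (by linarith) (c := ((ℓ : ℝ) ^ d * (1 - δ))⁻¹) (by positivity) ht
  refine ⟨B, _, hB, space_bound hd hℓ hℓd hn hε hε2 ht' ht1 ha, fun xs hxs => ?_⟩
  have hsub : ∀ v : V, ∀ x ∈ xs.filter (· ∈ window p ℓ v.1), x ∈ window p ℓ v.1 :=
    fun v x hx => by simpa using (List.mem_filter.1 hx).2
  have hloc : ∀ v : V, out v ((fun q => en v ((xs.filter (· ∈ window p ℓ v.1)).foldl (st v) q))^[k]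
      (q₀ v)) ∈ Set.Icc (unitDiscCover p (xs.filter (· ∈ window p ℓ v.1)) : ℝ)
        (r * unitDiscCover p (xs.filter (· ∈ window p ℓ v.1))) := fun v =>
    hout v k _ _ (hAapp v _ ⟨(List.length_filter_le _ _).trans hxs.1,
      fun x hx => hxs.2 x (List.mem_filter.1 hx).1⟩ (hsub v))
  have hmain := hBapp k xs
    (fun v => (unitDiscCover p (xs.filter (· ∈ window p ℓ v.1)) : ℝ)) r (by omega)
    (fun v hv => by rw [hv]; simp)
    (fun v hv => ⟨by exact_mod_cast one_le_unitDiscCover hv,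
      by rw [hMdef]; exact_mod_cast unitDiscCover_window_le hd v.1 (hsub v), hloc v⟩)
  refine hmain.trans (MeasureTheory.measure_mono ?_)
  set O : ℝ := ∑ v : V, (unitDiscCover p (xs.filter (· ∈ window p ℓ v.1)) : ℝ) with hO
  have hOV : O = ((∑ v ∈ V, unitDiscCover p (xs.filter (· ∈ window p ℓ v)) : ℕ) : ℝ) := by
    rw [hO, ← Finset.sum_coe_sort V]
    push_cast
    rfl
  have hlow : (ℓ : ℝ) ^ d * unitDiscCover p xs ≤ O := by
    rw [hOV]
    exact_mod_cast pow_mul_unitDiscCover_le hℓ V xs fun x hx v hv => hV x (hxs.2 x hx) v hv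
  have hupp : O ≤ ((ℓ : ℝ) + 1) ^ d * unitDiscCover p xs := by
    rw [hOV]
    exact_mod_cast sum_unitDiscCover_window_le ℓ V xs
  have hc : ((ℓ : ℝ) ^ d * (1 - δ))⁻¹ * ((1 - δ) * O) = O / (ℓ : ℝ) ^ d := by field_simp
  rintro σ ⟨h1, h2⟩
  refine ⟨le_trans ?_ h1, h2.trans ?_⟩
  · rw [hc, le_div_iff₀ (by positivity)]
    linarith
  rcases Nat.eq_zero_or_pos (unitDiscCover p xs) with h0 | hpos
  · have hO0 : O = 0 := by
      rw [h0] at hlow hupp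
      exact le_antisymm (by simpa using hupp) (by simpa using hlow)
    simp [hO0, h0]
  have hr : 0 ≤ r := by
    by_contra hneg
    have hOr : O ≤ r * O := by
      rw [hO, Finset.mul_sum]
      exact Finset.sum_le_sum fun v _ => (hloc v).1.trans (hloc v).2
    have hO0 : 0 < O := lt_of_lt_of_le (by positivity) hlow
    nlinarith
  have hratio : (1 + δ) / (1 - δ) ≤ 1 + ε := by
    rw [div_le_iff₀ hδ1', hδdef]
    nlinarith
  -- Counting all windows loses only `1 + 1 / ℓ` per coordinate, well within the claimed `1 + 4 /
  -- ℓ`.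
  have hshift : (((ℓ : ℝ) + 1) / ℓ) ^ d ≤ (1 + 4 / (ℓ : ℝ)) ^ d := by
    gcongr
    rw [add_div, div_self hℓ0.ne']
    gcongr
    norm_num
  calc ((ℓ : ℝ) ^ d * (1 - δ))⁻¹ * (r * ((1 + δ) * O))
      ≤ ((ℓ : ℝ) ^ d * (1 - δ))⁻¹ * (r * ((1 + δ) * (((ℓ : ℝ) + 1) ^ d * unitDiscCover p xs))) := by
        gcongr
    _ = (1 + δ) / (1 - δ) * (((ℓ : ℝ) + 1) / ℓ) ^ d * r * unitDiscCover p xs := by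
        rw [div_pow]
        field_simp
    _ ≤ (1 + ε) * (1 + 4 / (ℓ : ℝ)) ^ d * r * unitDiscCover p xs := by gcongr
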